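/- **Setting.** Let $\mathcal S$ be a finite set of sorts, $\mathcal F$ a set of features, and $\mathcal V$ a countably infinite set of tags (variables). Let $\preceq:\mathcal S\times\mathcal S\to[0,1]$ make $\mathcal S$ a bounded fuzzy lattice: $\preceq(s,s)=1$; $\min(\preceq(s,t),\preceq(t,r))\le\ \preceq(s,r)$; if $\preceq(s,t)>0$ and $\preceq(t,s)>0$ then $s=t$; any two sorts have a greatest lower bound with respect to the relation $\preceq(\cdot,\cdot)>0$; and there are sorts $\bot,\top$ with $\preceq(\bot,s)=\preceq(s,\top)=1$ for all $s$. Then the support $\{(s,t)\mid\ \preceq(s,t)>0\}$ is a (crisp) bounded lattice order on $\mathcal S$, with the same $\bot$, $\top$ and the same greatest lower bounds; it is the crisp sort order considered below. **Terms.** An OSF term is $t=X:s(f_1\to t_1,\dots,f_n\to t_n)$ with $n\ge 0$, $X\in\mathcal V$, $s\in\mathcal S$, $f_i\in\mathcal F$ and OSF terms $t_i$ (for $n=0$ it is the sorted variable $X:s$); $X$ is its root tag. It is *normal* if $s\ne\bot$, the $f_i$ are pairwise distinct, every $t_i$ is normal, and for every tag $Y$ there is at most one occurrence of $Y$ in $t$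 as the root tag of a subterm different from $Y:\top$. **Fuzzy semantics.** A fuzzy interpretation $\mathcal I$ consists of a set $\Delta$, functions $s^{\mathcal I}:\Delta\to[0,1]$ for $s\in\mathcal S$ and $f^{\mathcal I}:\Delta\to\Delta$ for $f\in\mathcal F$, such that $\top^{\mathcal I}\equiv 1$, $\bot^{\mathcal I}\equiv 0$, $\min(s^{\mathcal I}(d),\preceq(s,t))\le t^{\mathcal I}(d)$, and $\min(s^{\mathcal I}(d),t^{\mathcal I}(d))>0$ implies that the greatest lower bound of $s$ and $t$ has positive degree at $d$, for all $s,t\in\mathcal S$ and $d\in\Delta$. For $\alpha:\mathcal V\to\Delta$ and $t=X:s(f_1\to t_1,\dots,f_n\to t_n)$ put $$[\![t]\!]^{\mathcal I,\alpha}(d)=\min\Bigl(\mathbf 1_{\{\alpha(X)\}}(d),\ s^{\mathcal I}(d),\ \min_{1\le i\le n}[\![t_i]\!]^{\mathcal I,\alpha}(f_i^{\mathcal I}(d))\Bigr),\qquad [\![t]\!]^{\mathcal I}(d)=\sup_{\alpha:\mathcal V\to\Delta}[\![t]\!]^{\mathcal I,\alpha}(d),$$ where the minimum over no arguments is $1$.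 The fuzzy subsumption degree of terms is $$\preceq(t_1,t_2)=\sup\{\beta\in[0,1]\mid \min([\![t_1]\!]^{\mathcal I}(d),\beta)\le[\![t_2]\!]^{\mathcal I}(d)\text{ for every fuzzy interpretation }\mathcal I\text{ and every }d\in\Delta\}.$$ **Crisp semantics.** A crisp interpretation $\mathcal J$ consists of a set $\Delta$, subsets $s^{\mathcal J}\subseteq\Delta$ and functions $f^{\mathcal J}:\Delta\to\Delta$ such that $\top^{\mathcal J}=\Delta$, $\bot^{\mathcal J}=\emptyset$, $s^{\mathcal J}\subseteq t^{\mathcal J}$ whenever $s$ is below $t$ in the crisp sort order, and $s^{\mathcal J}\cap t^{\mathcal J}$ is contained in the interpretation of the greatest lower bound of $s$ and $t$. Put $$[\![t]\!]^{\mathcal J,\alpha}=\{\alpha(X)\}\cap s^{\mathcal J}\cap\bigcap_{1\le i\le n}(f_i^{\mathcal J})^{-1}\bigl([\![t_i]\!]^{\mathcal J,\alpha}\bigr),\qquad [\![t]\!]^{\mathcal J}=\bigcup_{\alpha:\mathcal V\to\Delta}[\![t]\!]^{\mathcal J,\alpha}.$$ The term $t_1$ is crisply subsumed by $t_2$ if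 $[\![t_1]\!]^{\mathcal J}\subseteq[\![t_2]\!]^{\mathcal J}$ for every crisp interpretation $\mathcal J$. **Theorem (Crisp and fuzzy subsumption).** For all normal OSF terms $\psi_1,\psi_2$: $\psi_1$ is crisply subsumed by $\psi_2$ (with respect to the crisp sort order given by the support of $\preceq$) if and only if $\preceq(\psi_1,\psi_2)>0$. -/

import Mathlib

universe uV uS uF uD

namespace OSF

/-- `m` is a greatest lower bound of `a` and `b` with respect to the relation `r`. -/
def IsGlb {S : Type uS} (r : S → S → Prop) (a b m : S) : Prop :=
  (r m a ∧ r m b) ∧ ∀ n : S, r n a → r n b → r n m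

/-- A crisp bounded lattice of sorts: a partial order in which every pair of elements has a
greatest lower bound, with least element `bot` and greatest element `top`.
(The set of sorts is finite in all uses, so least upper bounds exist as well.) -/
structure CrispSorts (S : Type uS) where
  isa : S → S → Prop
  refl : ∀ s, isa s s
  trans : ∀ s t r, isa s t → isa t r → isa s r
  antisymm : ∀ s t, isa s t → isa t s → s = t
  exists_glb : ∀ s t, ∃ m, IsGlb isa s t m
  bot : S
  top : S
  bot_isa : ∀ s, isa bot s
  isa_top : ∀ s, isa s top

/-- A fuzzy bounded lattice of sorts, with membership degrees in `[0,1]`, the minimum t-norm and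
strong fuzzy antisymmetry; greatest lower bounds are taken with respect to `s ≼ t`, which means
`isa s t > 0`. -/
structure FuzzySorts (S : Type uS) where
  isa : S → S → unitInterval
  refl : ∀ s, isa s s = 1
  trans : ∀ s t r, isa s t ⊓ isa t r ≤ isa s r
  antisymm : ∀ s t, 0 < isa s t → 0 < isa t s → s = t
  exists_glb : ∀ s t, ∃ m, IsGlb (fun a b => 0 < isa a b) s t m
  bot : S
  top : S
  bot_isa : ∀ s, isa bot s = 1
  isa_top : ∀ s, isa s top = 1

/-- The crisp bounded lattice whose order is the support of a fuzzy subsumption relation. -/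
def FuzzySorts.support {S : Type uS} (σ : FuzzySorts S) : CrispSorts S where
  isa s t := 0 < σ.isa s t
  refl s := by simp [σ.refl s]
  trans s t r h₁ h₂ := lt_of_lt_of_le (lt_inf_iff.mpr ⟨h₁, h₂⟩) (σ.trans s t r)
  antisymm := σ.antisymm
  exists_glb := σ.exists_glb
  bot := σ.bot
  top := σ.top
  bot_isa s := by simp [σ.bot_isa s]
  isa_top s := by simp [σ.isa_top s]

/-- OSF terms with tags in `V`, sorts in `S` and features in `F`: `node X s n f t` is
`X : s (f 0 → t 0, …, f (n-1) → t (n-1))`; for `n = 0` it is the sorted variable `X : s`. -/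
inductive Term (V : Type uV) (S : Type uS) (F : Type uF) : Type (max uS uF uV)
  | node (X : V) (s : S) (n : ℕ) (f : Fin n → F) (t : Fin n → Term V S F) : Term V S F

namespace Term

variable {V : Type uV} {S : Type uS} {F : Type uF}

open Classical in
/-- The number of occurrences of subterms in a term that have root tag `Y` and are different
from the bare sorted variable `Y : top`. -/
noncomputable def properOcc (top : S) (Y : V) : Term V S F → ℕ
  | node X s n _ t =>
    (if X = Y ∧ ¬ (s = top ∧ n = 0) then 1 else 0) + ∑ i, properOcc top Y (t i)

/-- Normal terms: non-bottom sorts, pairwise distinct features at each node, normal immediate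
subterms, and for each tag `Y` at most one occurrence of `Y` as the root of a subterm different
from `Y : top`. (A tag that does not occur in the term has no such occurrence.) -/
def Normal (bot top : S) : Term V S F → Prop
  | node X s n f t =>
    s ≠ bot ∧ Function.Injective f ∧ (∀ i, Normal bot top (t i)) ∧
      ∀ Y : V, properOcc top Y (node X s n f t) ≤ 1

end Term

/-- Fuzzy OSF interpretations with domain `D`. -/
structure FuzzyInterp {S : Type uS} (σ : FuzzySorts S) (F : Type uF) (D : Type uD) where
  sort : S → D → unitInterval
  feat : F → D → D
  sort_top : ∀ d, sort σ.top d = 1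
  sort_bot : ∀ d, sort σ.bot d = 0
  sort_isa : ∀ s t d, sort s d ⊓ σ.isa s t ≤ sort t d
  sort_glb : ∀ s t m, IsGlb (fun a b => 0 < σ.isa a b) s t m →
    ∀ d, 0 < sort s d ⊓ sort t d → 0 < sort m d

/-- Crisp OSF interpretations with domain `D`. -/
structure CrispInterp {S : Type uS} (κ : CrispSorts S) (F : Type uF) (D : Type uD) where
  sort : S → Set D
  feat : F → D → D
  sort_top : sort κ.top = Set.univ
  sort_bot : sort κ.bot = ∅
  sort_isa : ∀ s t, κ.isa s t → sort s ⊆ sort t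
  sort_glb : ∀ s t m, IsGlb κ.isa s t m → sort s ∩ sort t ⊆ sort m

section Denotation

variable {V : Type uV} {S : Type uS} {F : Type uF} {D : Type uD}

/-- The fuzzy denotation of a term under an assignment; `⊓` and `⨅` are minima in `[0,1]`. -/
noncomputable def FuzzyInterp.denAt {σ : FuzzySorts S} (J : FuzzyInterp σ F D) (α : V → D) :
    Term V S F → D → unitInterval
  | .node X s _ f t => fun d =>
    Set.indicator {α X} (fun _ => (1 : unitInterval)) d ⊓ J.sort s d ⊓
      ⨅ i, FuzzyInterp.denAt J α (t i) (J.feat (f i) d)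

/-- The fuzzy denotation of a term: the union of its denotations under all assignments. -/
noncomputable def FuzzyInterp.den {σ : FuzzySorts S} (J : FuzzyInterp σ F D)
    (t : Term V S F) (d : D) : unitInterval :=
  ⨆ α : V → D, J.denAt α t d

/-- The crisp denotation of a term under an assignment. -/
def CrispInterp.denAt {κ : CrispSorts S} (J : CrispInterp κ F D) (α : V → D) :
    Term V S F → Set D
  | .node X s _ f t =>
    {α X} ∩ J.sort s ∩ ⋂ i, J.feat (f i) ⁻¹' (CrispInterp.denAt J α (t i))

/-- The crisp denotation of a term. -/
def CrispInterp.den {κ : CrispSorts S} (J : CrispInterp κ F D) (t : Term V S F) : Set D :=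
  ⋃ α : V → D, J.denAt α t

end Denotation

/-- Crisp (semantic) term subsumption: inclusion of denotations in every crisp interpretation
(with domain in a fixed universe). -/
def CrispSorts.Subsumed {V : Type uV} {S : Type uS} {F : Type uF} (κ : CrispSorts S)
    (t₁ t₂ : Term V S F) : Prop :=
  ∀ (D : Type uD) (J : CrispInterp κ F D), J.den t₁ ⊆ J.den t₂

/-- The fuzzy (semantic) term subsumption degree: the supremum of all `β ∈ [0,1]` such that
`[t₁](e) ∧ β ≤ [t₂](e)` for every fuzzy interpretation and every element `e` of its domain. -/
noncomputable def FuzzySorts.subsumption {V : Type uV} {S : Type uS} {F : Type uF}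
    (σ : FuzzySorts S) (t₁ t₂ : Term V S F) : unitInterval :=
  sSup {β : unitInterval | ∀ (D : Type uD) (J : FuzzyInterp σ F D) (e : D),
    J.den t₁ e ⊓ β ≤ J.den t₂ e}

end OSF

/-! A crisp interpretation is a fuzzy one with degrees 0 and 1, so a positive fuzzy degree forces
crisp subsumption.

Conversely, let `β` be the least positive degree of sort subsumption; it is positive because there
are finitely many sorts. Suppose `ψ₁` has positive degree at `e` under `α`. The graph of `ψ₁`,
completed by a copy of the domain, is a crisp interpretation in which the root of `ψ₁` satisfies
`ψ₁`, hence also `ψ₂`. Projecting back to the domain commutes with features (`graphProj_graphFeat`)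
and respects sorts up to the degree of `ψ₁` (`denAt_le_sort_graphProj`); passing to a larger sort
costs at most `β`. So `ψ₂` has degree at least `[ψ₁](e) ⊓ β` at `e` (`inf_le_denAt_graphProj`). -/

namespace OSF

/-! ### Subterms and tags of normal terms -/

namespace Term

variable {V : Type uV} {S : Type uS} {F : Type uF}

/-- The root tag of a term. -/
def root : Term V S F → V
  | node X _ _ _ _ => X

/-- The root sort of a term. -/
def rootSort : Term V S F → S
  | node _ s _ _ _ => s

/-- `u.Child g v`: the term `v` is the argument of the feature `g` at the root of `u`. -/
inductive Child : Term V S F → F → Term V S F → Prop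
  | mk (X : V) (s : S) (n : ℕ) (f : Fin n → F) (t : Fin n → Term V S F) (i : Fin n) :
      Child (node X s n f t) (f i) (t i)

/-- `u.Subterm t`: the term `u` occurs in `t`. -/
inductive Subterm (u : Term V S F) : Term V S F → Prop
  | refl : Subterm u u
  | arg (X : V) (s : S) (n : ℕ) (f : Fin n → F) (t : Fin n → Term V S F) (i : Fin n) :
      Subterm u (t i) → Subterm u (node X s n f t)

/-- A term different from a bare variable of sort `top`. -/
def Proper (top : S) : Term V S F → Prop
  | node _ s n _ _ => ¬ (s = top ∧ n = 0)

theorem Subterm.child {u v ψ : Term V S F} {g : F} (h : u.Subterm ψ) (hc : u.Child g v) :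
    v.Subterm ψ := by
  induction h with
  | refl =>
    obtain ⟨X, s, n, f, t, i⟩ := hc
    exact .arg X s n f t i .refl
  | arg X s n f t i _ ih => exact .arg X s n f t i ih

theorem Subterm.normal {bot top : S} {u ψ : Term V S F} (h : u.Subterm ψ)
    (hψ : ψ.Normal bot top) : u.Normal bot top := by
  induction h with
  | refl => exact hψ
  | arg X s n f t i _ ih =>
    simp only [Normal] at hψ
    exact ih (hψ.2.2.1 i)

theorem Normal.rootSort_ne_bot {bot top : S} {u : Term V S F} (h : u.Normal bot top) :
    u.rootSort ≠ bot := by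
  cases u
  simp only [Normal] at h
  exact h.1

theorem Normal.child_unique {bot top : S} {u v w : Term V S F} {g : F}
    (h : u.Normal bot top) (hv : u.Child g v) (hw : u.Child g w) : v = w := by
  obtain ⟨X, s, n, f, t, i⟩ := hv
  simp only [Normal] at h
  generalize hg : f i = g at hw
  cases hw with
  | mk _ _ _ _ _ j => rw [h.2.1 hg]

theorem Normal.properOcc_le_one {bot top : S} {u : Term V S F} (h : u.Normal bot top) (Y : V) :
    u.properOcc top Y ≤ 1 := by
  cases u
  simp only [Normal] at h
  exact h.2.2.2 Y

theorem properOcc_arg_le (top : S) (Y X : V) (s : S) (n : ℕ) (f : Fin n → F)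
    (t : Fin n → Term V S F) (i : Fin n) :
    (t i).properOcc top Y ≤ (node X s n f t).properOcc top Y := by
  rw [properOcc]
  exact le_add_left
    (Finset.single_le_sum (f := fun j => (t j).properOcc top Y) (fun _ _ => Nat.zero_le _)
      (Finset.mem_univ i))

theorem Proper.one_le_properOcc {top : S} {u : Term V S F} (h : u.Proper top) :
    1 ≤ u.properOcc top u.root := by
  cases u
  simp only [Proper] at h
  rw [properOcc, root, if_pos ⟨rfl, h⟩]
  exact Nat.le_add_right _ _

theorem Subterm.one_le_properOcc {top : S} {u ψ : Term V S F} (h : u.Subterm ψ)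
    (hu : u.Proper top) : 1 ≤ ψ.properOcc top u.root := by
  induction h with
  | refl => exact hu.one_le_properOcc
  | arg X s n f t i _ ih => exact ih.trans (properOcc_arg_le ..)

/-- The root counts once, and the occurrence inside an argument counts again. -/
theorem two_le_properOcc_of_arg {top : S} {u : Term V S F} {X : V} {s : S} {n : ℕ}
    {f : Fin n → F} {t : Fin n → Term V S F} {i : Fin n} (h : u.Subterm (t i))
    (hu : u.Proper top) (hroot : u.root = X) (hp : (node X s n f t).Proper top) :
    2 ≤ (node X s n f t).properOcc top X := by
  simp only [Proper] at hp
  have h1 := h.one_le_properOcc hu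
  have h2 := Finset.single_le_sum (f := fun j => (t j).properOcc top X)
    (fun _ _ => Nat.zero_le _) (Finset.mem_univ i)
  rw [hroot] at h1
  rw [properOcc, if_pos ⟨rfl, hp⟩]
  exact Nat.add_le_add_left (h1.trans h2) 1

/-- A tag with at most one proper occurrence determines the subterm occurring there. -/
theorem Subterm.eq_of_properOcc_le_one {top : S} {u v ψ : Term V S F}
    (hu : u.Subterm ψ) (hv : v.Subterm ψ) (pu : u.Proper top) (pv : v.Proper top)
    (hroot : u.root = v.root) (h : ψ.properOcc top u.root ≤ 1) : u = v := by
  induction hu with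
  | refl =>
    cases hv with
    | refl => rfl
    | arg X s n f t i hi =>
      exact absurd (two_le_properOcc_of_arg hi pv hroot.symm pu) (not_le.mpr (Nat.lt_succ_of_le h))
  | arg X s n f t i hi ih =>
    cases hv with
    | refl =>
      rw [hroot] at h
      exact absurd (two_le_properOcc_of_arg hi pu hroot pv) (not_le.mpr (Nat.lt_succ_of_le h))
    | arg _ _ _ _ _ j hj =>
      by_cases hij : i = j
      · subst hij
        exact ih hj ((properOcc_arg_le ..).trans h)
      -- Occurrences in distinct arguments each add at least one to the sum.
      · exfalso
        have h1 := hi.one_le_properOcc pu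
        have h2 := hj.one_le_properOcc pv
        rw [← hroot] at h2
        rw [properOcc] at h
        have h3 := Finset.add_le_sum (f := fun j => (t j).properOcc top u.root)
          (fun _ _ => Nat.zero_le _) (Finset.mem_univ i) (Finset.mem_univ j) hij
        omega

open Classical in
/-- The proper subterm of `ψ` with root tag `X`, or the bare variable `X : top` if there is
none. -/
noncomputable def subtermAt (top : S) (ψ : Term V S F) (X : V) : Term V S F :=
  if h : ∃ u : Term V S F, u.Subterm ψ ∧ u.Proper top ∧ u.root = X then h.choose
  else node X top 0 Fin.elim0 Fin.elim0

theorem subtermAt_spec (top : S) (ψ : Term V S F) (X : V) :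
    ((subtermAt top ψ X).Subterm ψ ∧ (subtermAt top ψ X).root = X) ∨
      subtermAt top ψ X = node X top 0 Fin.elim0 Fin.elim0 := by
  unfold subtermAt
  split_ifs with h
  · exact .inl ⟨h.choose_spec.1, h.choose_spec.2.2⟩
  · exact .inr rfl

/-- Normality makes the choice in `subtermAt` canonical. -/
theorem Subterm.subtermAt_root {bot top : S} {u ψ : Term V S F} (hψ : ψ.Normal bot top)
    (hu : u.Subterm ψ) (pu : u.Proper top) : subtermAt top ψ u.root = u := by
  have h : ∃ v : Term V S F, v.Subterm ψ ∧ v.Proper top ∧ v.root = u.root := ⟨u, hu, pu, rfl⟩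
  unfold subtermAt
  rw [dif_pos h]
  obtain ⟨h1, h2, h3⟩ := h.choose_spec
  exact h1.eq_of_properOcc_le_one hu h2 pu h3 (hψ.properOcc_le_one _)

/-- The default value of `subtermAt` has no arguments, so a child rules it out. -/
theorem subtermAt_child {top : S} {ψ v : Term V S F} {X : V} {g : F}
    (h : (subtermAt top ψ X).Child g v) :
    (subtermAt top ψ X).Subterm ψ ∧ (subtermAt top ψ X).root = X := by
  refine (subtermAt_spec top ψ X).resolve_right fun he => ?_
  rw [he] at h
  cases h with
  | mk _ _ _ _ _ i => exact i.elim0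

end Term

open Term

variable {V : Type uV} {S : Type uS} {F : Type uF} {D : Type uD}

/-! ### From fuzzy to crisp subsumption -/

section Support

variable {σ : FuzzySorts S}

/-- A crisp interpretation, regarded as a fuzzy one with degrees `0` and `1`. -/
noncomputable def CrispInterp.toFuzzy (J : CrispInterp σ.support F D) : FuzzyInterp σ F D where
  sort s := (J.sort s).indicator fun _ => (1 : unitInterval)
  feat := J.feat
  sort_top d := by
    have h : d ∈ J.sort σ.top := J.sort_top ▸ Set.mem_univ d
    simp [h]
  sort_bot d := by
    have h : d ∉ J.sort σ.bot := J.sort_bot ▸ Set.notMem_empty d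
    simp [h]
  sort_isa s t d := by
    by_cases hs : d ∈ J.sort s
    · rcases eq_or_lt_of_le (unitInterval.nonneg' (t := σ.isa s t)) with h0 | h0
      · rw [← h0]
        exact inf_le_right.trans unitInterval.nonneg'
      · rw [Set.indicator_of_mem (J.sort_isa s t h0 hs)]
        exact unitInterval.le_one'
    · rw [Set.indicator_of_notMem hs]
      exact inf_le_left.trans unitInterval.nonneg'
  sort_glb s t m hm d hd := by
    obtain ⟨h1, h2⟩ := lt_inf_iff.mp hd
    have hs : d ∈ J.sort s := Set.mem_of_indicator_ne_zero h1.ne'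
    have ht : d ∈ J.sort t := Set.mem_of_indicator_ne_zero h2.ne'
    rw [Set.indicator_of_mem (J.sort_glb s t m hm ⟨hs, ht⟩)]
    exact zero_lt_one

theorem CrispInterp.one_le_toFuzzy_denAt (J : CrispInterp σ.support F D) (α : V → D)
    (t : Term V S F) (d : D) (h : d ∈ J.denAt α t) : 1 ≤ J.toFuzzy.denAt α t d := by
  induction t generalizing d with
  | node X s n f t ih =>
    rw [CrispInterp.denAt] at h
    obtain ⟨⟨hX, hs⟩, ht⟩ := h
    rw [FuzzyInterp.denAt]
    refine le_inf (le_inf ?_ ?_) (le_iInf fun i => ih i _ (Set.mem_iInter.mp ht i))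
    · rw [Set.indicator_of_mem hX]
    · exact (Set.indicator_of_mem hs fun _ => (1 : unitInterval)).ge

theorem CrispInterp.mem_denAt_of_toFuzzy_pos (J : CrispInterp σ.support F D) (α : V → D)
    (t : Term V S F) (d : D) (h : 0 < J.toFuzzy.denAt α t d) : d ∈ J.denAt α t := by
  induction t generalizing d with
  | node X s n f t ih =>
    rw [FuzzyInterp.denAt] at h
    obtain ⟨h, ht⟩ := lt_inf_iff.mp h
    obtain ⟨hX, hs⟩ := lt_inf_iff.mp h
    rw [CrispInterp.denAt]
    exact ⟨⟨Set.mem_of_indicator_ne_zero hX.ne',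
        Set.mem_of_indicator_ne_zero (s := J.sort s)
          (f := fun _ => (1 : unitInterval)) hs.ne'⟩,
      Set.mem_iInter.mpr fun i => ih i _ (ht.trans_le (iInf_le _ i))⟩

/-- Crisp subsumption holds as soon as the fuzzy subsumption degree is positive. -/
theorem FuzzySorts.subsumed_of_subsumption_pos {t₁ t₂ : Term V S F}
    (h : 0 < FuzzySorts.subsumption.{uV, uS, uF, uD} σ t₁ t₂) :
    CrispSorts.Subsumed.{uV, uS, uF, uD} σ.support t₁ t₂ := by
  obtain ⟨β, hβ, hpos⟩ := lt_sSup_iff.mp h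
  intro D J d hd
  obtain ⟨α, hα⟩ := Set.mem_iUnion.mp hd
  have h1 : 1 ≤ J.toFuzzy.den t₁ d :=
    (J.one_le_toFuzzy_denAt α t₁ d hα).trans (le_iSup (fun α => J.toFuzzy.denAt α t₁ d) α)
  have h2 : 0 < J.toFuzzy.den t₂ d :=
    (lt_inf_iff.mpr ⟨zero_lt_one.trans_le h1, hpos⟩).trans_le (hβ D J.toFuzzy d)
  obtain ⟨α', hα'⟩ := lt_iSup_iff.mp h2
  exact Set.mem_iUnion.mpr ⟨α', J.mem_denAt_of_toFuzzy_pos α' t₂ d hα'⟩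

end Support

/-! ### Consequences of a positive degree -/

namespace FuzzyInterp

variable {σ : FuzzySorts S} (J : FuzzyInterp σ F D) {α : V → D}

theorem eq_of_denAt_pos {t : Term V S F} {d : D} (h : 0 < J.denAt α t d) : d = α t.root := by
  obtain ⟨X, s, n, f, t⟩ := t
  rw [denAt] at h
  exact Set.mem_of_indicator_ne_zero (s := {α X}) (lt_inf_iff.mp (lt_inf_iff.mp h).1).1.ne'

theorem denAt_le_sort (t : Term V S F) (d : D) : J.denAt α t d ≤ J.sort t.rootSort d := by
  cases t
  rw [denAt]
  exact inf_le_left.trans inf_le_right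

theorem denAt_le_child {u v : Term V S F} {g : F} (h : u.Child g v) (d : D) :
    J.denAt α u d ≤ J.denAt α v (J.feat g d) := by
  obtain ⟨X, s, n, f, t, i⟩ := h
  rw [denAt]
  exact inf_le_right.trans (iInf_le _ i)

/-- Degrees grow along a feature path, and positivity forces each element reached to be the value of
the tag there. -/
theorem denAt_le_subterm {u ψ : Term V S F} {d : D} (h : u.Subterm ψ)
    (hpos : 0 < J.denAt α ψ d) : J.denAt α ψ d ≤ J.denAt α u (α u.root) := by
  induction h generalizing d with
  | refl => rw [← J.eq_of_denAt_pos hpos]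
  | arg X s n f t i _ ih =>
    have hle := J.denAt_le_child (α := α) (.mk X s n f t i) d
    exact hle.trans (ih (hpos.trans_le hle))

/-- In other words, `α` respects the edges of the term graph. -/
theorem feat_root {u v ψ : Term V S F} {g : F} {d : D} (h : u.Subterm ψ) (hc : u.Child g v)
    (hpos : 0 < J.denAt α ψ d) : J.feat g (α u.root) = α v.root :=
  J.eq_of_denAt_pos
    ((hpos.trans_le (J.denAt_le_subterm h hpos)).trans_le (J.denAt_le_child hc _))

end FuzzyInterp

/-! Given a fuzzy interpretation and an assignment, the graph of a normal term is completed to a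
crisp interpretation: features missing at a tag lead into the domain of the given interpretation,
whose elements only carry the top sort. -/

section Graph

variable {W : Type uD} (σ : FuzzySorts S) (J : FuzzyInterp σ F D) (ψ : Term V S F) (α : V → D)
  (ε : V ≃ W)

/-- The sort of an element of the completed term graph. -/
noncomputable def graphSort : W ⊕ D → S
  | .inl w => (subtermAt σ.top ψ (ε.symm w)).rootSort
  | .inr _ => σ.top

open Classical in
/-- The features of the completed term graph. -/
noncomputable def graphFeat (g : F) : W ⊕ D → W ⊕ D
  | .inl w =>
    if h : ∃ v, (subtermAt σ.top ψ (ε.symm w)).Child g v then .inl (ε h.choose.root)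
    else .inr (J.feat g (α (ε.symm w)))
  | .inr d => .inr (J.feat g d)

/-- The projection of the completed term graph to the given interpretation. -/
def graphProj : W ⊕ D → D :=
  Sum.elim (fun w => α (ε.symm w)) id

variable {σ ψ}

theorem graphSort_ne_bot (hψ : ψ.Normal σ.bot σ.top) (x : W ⊕ D) :
    graphSort σ ψ ε x ≠ σ.bot := by
  -- If top and bottom coincided, the root sort of `ψ` would be bottom.
  have htop : σ.top ≠ σ.bot := fun h => hψ.rootSort_ne_bot <|
    σ.antisymm _ _ (by rw [← h, σ.isa_top]; exact zero_lt_one)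
      (by rw [σ.bot_isa]; exact zero_lt_one)
  rcases x with w | d
  · rcases subtermAt_spec σ.top ψ (ε.symm w) with h | h
    · exact (h.1.normal hψ).rootSort_ne_bot
    · simpa only [graphSort, h, rootSort] using htop
  · exact htop

/-- The crisp interpretation given by the completed graph of a normal term. -/
noncomputable def graphInterp (hψ : ψ.Normal σ.bot σ.top) :
    CrispInterp σ.support F (W ⊕ D) where
  sort s := {x | 0 < σ.isa (graphSort σ ψ ε x) s}
  feat := graphFeat σ J ψ α ε
  sort_top := Set.eq_univ_of_forall fun x => by
    change 0 < σ.isa _ σ.top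
    rw [σ.isa_top]
    exact zero_lt_one
  sort_bot := Set.eq_empty_of_forall_notMem fun x hx =>
    graphSort_ne_bot ε hψ x
      (σ.antisymm _ _ hx (by rw [σ.bot_isa]; exact zero_lt_one))
  sort_isa s t hst x hx := σ.support.trans _ _ _ hx hst
  -- An element carries exactly the sorts above its own, a set closed under greatest lower bounds.
  sort_glb s t m hm x hx := hm.2 _ hx.1 hx.2

theorem graphInterp_mem_denAt (hψ : ψ.Normal σ.bot σ.top) (u : Term V S F) (hu : u.Subterm ψ) :
    (.inl (ε u.root) : W ⊕ D) ∈ (graphInterp J α ε hψ).denAt (fun X => .inl (ε X)) u := by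
  induction u with
  | node X s n f t ih =>
    rw [CrispInterp.denAt]
    by_cases hp : (node X s n f t).Proper σ.top
    · have hat : subtermAt σ.top ψ X = node X s n f t := hu.subtermAt_root hψ hp
      refine ⟨⟨rfl, ?_⟩, Set.mem_iInter.mpr fun i => ?_⟩
      · change 0 < σ.isa (subtermAt σ.top ψ (ε.symm (ε X))).rootSort s
        rw [ε.symm_apply_apply, hat, rootSort, σ.refl]
        exact zero_lt_one
      · have hc : (node X s n f t).Child (f i) (t i) := .mk X s n f t i
        have hex : ∃ v, (subtermAt σ.top ψ (ε.symm (ε X))).Child (f i) v :=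
          ⟨t i, by rwa [ε.symm_apply_apply, hat]⟩
        have hch : hex.choose = t i := by
          refine (hu.normal hψ).child_unique ?_ hc
          simpa only [ε.symm_apply_apply, hat] using hex.choose_spec
        have hfeat : graphFeat σ J ψ α ε (f i) (.inl (ε X)) = .inl (ε (t i).root) := by
          rw [graphFeat, dif_pos hex, hch]
        rw [Set.mem_preimage]
        change graphFeat σ J ψ α ε (f i) (.inl (ε X)) ∈ _
        rw [hfeat]
        exact ih i (hu.child hc)
    -- A bare `X : top` need not be the subterm stored at `X`, but it imposes no condition on sorts
    -- or features.
    · simp only [Proper, not_not] at hp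
      obtain ⟨rfl, rfl⟩ := hp
      refine ⟨⟨rfl, ?_⟩, Set.mem_iInter.mpr fun i => i.elim0⟩
      exact (graphInterp J α ε hψ).sort_top ▸ Set.mem_univ _

variable {J α}

/-- On term edges this is `feat_root`; elsewhere the completion was chosen to make it hold. -/
theorem graphProj_graphFeat {e : D} (hpos : 0 < J.denAt α ψ e) (g : F) (x : W ⊕ D) :
    graphProj α ε (graphFeat σ J ψ α ε g x) = J.feat g (graphProj α ε x) := by
  rcases x with w | d
  · rw [graphFeat]
    split_ifs with h
    · obtain ⟨h1, h2⟩ := subtermAt_child h.choose_spec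
      have h3 := J.feat_root h1 h.choose_spec hpos
      rw [h2] at h3
      simp only [graphProj, Sum.elim_inl, ε.symm_apply_apply, h3]
    · rfl
  · rfl

theorem denAt_le_sort_graphProj {e : D} (hpos : 0 < J.denAt α ψ e) (x : W ⊕ D) :
    J.denAt α ψ e ≤ J.sort (graphSort σ ψ ε x) (graphProj α ε x) := by
  rcases x with w | d
  · rcases subtermAt_spec σ.top ψ (ε.symm w) with ⟨h1, h2⟩ | h
    · have h3 := (J.denAt_le_subterm h1 hpos).trans (J.denAt_le_sort _ _)
      rwa [h2] at h3
    · simp only [graphSort, h, rootSort, J.sort_top]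
      exact unitInterval.le_one'
  · simp only [graphSort, J.sort_top]
    exact unitInterval.le_one'

/-- Membership in a denotation over the completed term graph is carried to the given
interpretation, up to the least positive degree of sort subsumption. -/
theorem inf_le_denAt_graphProj {e : D} (hψ : ψ.Normal σ.bot σ.top) (hpos : 0 < J.denAt α ψ e)
    {β : unitInterval} (hβ : ∀ s t, 0 < σ.isa s t → β ≤ σ.isa s t) (α' : V → W ⊕ D)
    (t : Term V S F) (x : W ⊕ D) (h : x ∈ (graphInterp J α ε hψ).denAt α' t) :
    J.denAt α ψ e ⊓ β ≤ J.denAt (fun X => graphProj α ε (α' X)) t (graphProj α ε x) := by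
  induction t generalizing x with
  | node X s n f t ih =>
    rw [CrispInterp.denAt] at h
    obtain ⟨⟨hX, hs⟩, ht⟩ := h
    rw [FuzzyInterp.denAt]
    refine le_inf (le_inf ?_ ?_) (le_iInf fun i => ?_)
    · rw [Set.indicator_of_mem (by rw [Set.mem_singleton_iff.mp hX]; rfl)]
      exact unitInterval.le_one'
    · exact (inf_le_inf (denAt_le_sort_graphProj ε hpos x) (hβ _ _ hs)).trans
        (J.sort_isa _ _ _)
    · rw [← graphProj_graphFeat ε hpos]
      exact ih i _ (Set.mem_iInter.mp ht i)

end Graph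

/-! ### From crisp to fuzzy subsumption -/

theorem FuzzySorts.exists_pos_le_isa [Finite S] (σ : FuzzySorts S) :
    ∃ β : unitInterval, 0 < β ∧ ∀ s t, 0 < σ.isa s t → β ≤ σ.isa s t := by
  obtain ⟨p, hp, hmin⟩ := Set.exists_min_image {p : S × S | 0 < σ.isa p.1 p.2}
    (fun p => σ.isa p.1 p.2) (Set.toFinite _)
    ⟨(σ.top, σ.top), by simp [σ.refl σ.top]⟩
  exact ⟨σ.isa p.1 p.2, hp, fun s t h => hmin (s, t) h⟩

/-- The fuzzy subsumption degree is positive as soon as crisp subsumption holds. -/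
theorem FuzzySorts.subsumption_pos_of_subsumed [Countable V] [Finite S] {σ : FuzzySorts S}
    {ψ₁ ψ₂ : Term V S F} (h₁ : ψ₁.Normal σ.bot σ.top)
    (h : CrispSorts.Subsumed.{uV, uS, uF, uD} σ.support ψ₁ ψ₂) :
    0 < FuzzySorts.subsumption.{uV, uS, uF, uD} σ ψ₁ ψ₂ := by
  obtain ⟨β, hpos, hβ⟩ := σ.exists_pos_le_isa
  refine hpos.trans_le (le_sSup fun D J e => ?_)
  by_contra! hlt
  obtain ⟨h1, h2⟩ := lt_inf_iff.mp hlt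
  -- The supremum need not be attained; the strict inequality still supplies a single assignment.
  obtain ⟨α, hα⟩ := lt_iSup_iff.mp h1
  have hα0 : 0 < J.denAt α ψ₁ e := unitInterval.nonneg'.trans_lt hα
  -- Crisp subsumption only tests domains in universe `uD`; countability lets the tags be copied
  -- there.
  let ε := equivShrink.{uD} V
  have hmem := h _ (graphInterp J α ε h₁)
    (Set.mem_iUnion.mpr ⟨_, graphInterp_mem_denAt J α ε h₁ ψ₁ .refl⟩)
  obtain ⟨α', hα'⟩ := Set.mem_iUnion.mp hmem
  have hle := inf_le_denAt_graphProj ε h₁ hα0 hβ α' ψ₂ _ hα'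
  have he : graphProj α ε (.inl (ε ψ₁.root)) = e := by
    rw [J.eq_of_denAt_pos hα0, graphProj, Sum.elim_inl, ε.symm_apply_apply]
  rw [he] at hle
  exact ((lt_inf_iff.mpr ⟨hα, h2⟩).trans_le hle).not_ge
    (le_iSup (fun α => J.denAt α ψ₂ e) _)

end OSF

theorem mainTheorem4 {V : Type uV} {S : Type uS} {F : Type uF}
    [Countable V] [Infinite V] [Finite S] (σ : OSF.FuzzySorts S)
    (ψ₁ ψ₂ : OSF.Term V S F)
    (h₁ : ψ₁.Normal σ.bot σ.top) (h₂ : ψ₂.Normal σ.bot σ.top) :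
    OSF.CrispSorts.Subsumed.{uV, uS, uF, uD} σ.support ψ₁ ψ₂ ↔
      0 < OSF.FuzzySorts.subsumption.{uV, uS, uF, uD} σ ψ₁ ψ₂ :=
  ⟨OSF.FuzzySorts.subsumption_pos_of_subsumed h₁, OSF.FuzzySorts.subsumed_of_subsumption_pos⟩
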